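/- For a finite simple graph $G$, a weighting $w:E(G)\to\{1,\dots,k\}$ is a vertex-coloring $k$-edge-weighting if the vertex sums $c(v)=\sum_{e\ni v}w(e)$ satisfy $c(x)\ne c(y)$ for every edge $xy$; $\mu(G)$ denotes the least $k$ for which $G$ has one. For integers $a,b,c,d,e,f\ge 0$ let $G$ be the graph formed by four corners $u,v,u',v'$ and six internally disjoint paths $p_1,\dots,p_6$ of lengths $a,b,c,d,e,f$, where $p_1,p_2$ join $u$ and $v$, $p_3,p_4$ join $u'$ and $v'$, $p_5$ joins $u$ and $u'$, and $p_6$ joins $v$ and $v'$. A path of length $0$ means that its two end corners are identified (and there are no other identifications); a path whose end corners are identified is closed, i.e. a cycle if its length is positive. These are the generalized polygon trees with at most three interior regions (bounded by $p_1\cup p_2$, $p_2\cup p_5\cup p_3\cup p_6$ and $p_3\cup p_4$). Assume that $G$ is a simple bipartite graph with at least three vertices. Consider the relabellings of the lengths generated by the symmetries of the figure $a\leftrightarrow b$; $c\leftrightarrow d$; $e\leftrightarrow f$; and $(a,b,c,d)\mapsto(d,c,b,a)$. Then $\mu(G)=1$ if and only if, after one of these relabellings, one of the following holds: 1. $a=b=c=d=e=f=2$;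 2. $a=b=e+f=2$ and $c=d=0$; 3. $a=d=f=2$, $b=c=1$ and $e=0$; 4. $a=d=f=2$, $b=c=2$ and $e=0$; 5. $a=b=c=d=2$ and $e=f=0$. Moreover, $\mu(G)=3$ if and only if, after one of these relabellings, one of the following holds: 1. $a=b=c=d=0$ and $e+f\equiv 2\pmod 4$; 2. $b=1$, $c=d=0$ and $a\equiv e+f\equiv 1\pmod 4$; 3. $b=1$, $e=f=0$ and $a\equiv c\equiv d\equiv 1\pmod 4$; 4. $b=c=1$, $a\equiv d\equiv e\equiv 1\pmod 4$ and $f\equiv 3\pmod 4$; 5. $b=c=d=e=f=0$ and $a\equiv 2\pmod 4$; 6. $c=d=0$, $e+f=1$ and $a\equiv b\equiv 1\pmod 4$. In all other cases $\mu(G)=2$. -/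

import Mathlib

/-- The colour induced at the vertex `v` by the edge weighting `w`:
the sum of the weights of the edges incident to `v`. -/
def inducedColor {V : Type*} [Fintype V] (G : SimpleGraph V) [DecidableRel G.Adj]
    (w : G.edgeSet → ℕ) (v : V) : ℕ :=
  ∑ x : G.neighborSet v, w ⟨s(v, x.1), x.2⟩

/-- `w` is a vertex-coloring `k`-edge-weighting of `G`: all weights lie in `{1, …, k}` and
adjacent vertices receive different induced colours. -/
def IsVCEW {V : Type*} [Fintype V] (G : SimpleGraph V) [DecidableRel G.Adj]
    (k : ℕ) (w : G.edgeSet → ℕ) : Prop :=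
  (∀ e, 1 ≤ w e ∧ w e ≤ k) ∧
    ∀ x y, G.Adj x y → inducedColor G w x ≠ inducedColor G w y

/-- The least `k` for which `G` has a vertex-coloring `k`-edge-weighting. (If there were no such
`k`, the value would be `0`; a graph with an edge and at least one such `k` has value `≥ 1`.) -/
noncomputable def mu {V : Type*} [Fintype V] (G : SimpleGraph V) [DecidableRel G.Adj] : ℕ :=
  sInf {k : ℕ | ∃ w : G.edgeSet → ℕ, IsVCEW G k w}

/-- The four corners `u, v, u', v'` are numbered `0, 1, 2, 3`. The six paths `p₁, …, p₆` are
numbered `0, …, 5`: `p₁, p₂` join `u` to `v`, `p₃, p₄` join `u'` to `v'`, `p₅` joins `u` to `u'`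
and `p₆` joins `v` to `v'`. This is the corner in which a path starts. -/
def pathStart : Fin 6 → Fin 4 := ![0, 0, 2, 2, 0, 1]

/-- The corner in which a path ends. -/
def pathEnd : Fin 6 → Fin 4 := ![1, 1, 3, 3, 2, 3]

/-- A presentation of the simple graph `G` as the generalized polygon tree with (at most) three
interior regions whose paths `p₁, …, p₆` have lengths `len 0, …, len 5`. The regions are bounded
by `p₁ ∪ p₂`, by `p₂ ∪ p₅ ∪ p₃ ∪ p₆` and by `p₃ ∪ p₄`. A path of length `0` identifies its two end
corners (and a path whose end corners are identified is a closed one). Apart from that, the paths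
are internally disjoint, and they make up the whole graph; no edge is used twice. -/
structure PolygonFigure {V : Type*} (G : SimpleGraph V) (len : Fin 6 → ℕ) where
  /-- the corners `u, v, u', v'` -/
  corner : Fin 4 → V
  /-- the paths `p₁, …, p₆` -/
  path : (i : Fin 6) → G.Walk (corner (pathStart i)) (corner (pathEnd i))
  length_path : ∀ i, (path i).length = len i
  /-- corners coincide only if they are linked by paths of length `0` -/
  corner_eq : ∀ x y, corner x = corner y →
    Relation.EqvGen (fun s t => ∃ i, len i = 0 ∧ pathStart i = s ∧ pathEnd i = t) x y
  /-- an inner vertex of a path is not a corner -/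
  inner_ne_corner : ∀ i, ∀ k < len i, 0 < k → ∀ x, (path i).getVert k ≠ corner x
  /-- an inner vertex occurs on one path only, and only once -/
  inner_inj : ∀ i j, ∀ k < len i, ∀ l < len j, 0 < k → 0 < l →
    (path i).getVert k = (path j).getVert l → i = j ∧ k = l
  /-- an edge occurs on one path only, and only once -/
  edge_inj : ∀ i j, ∀ k < len i, ∀ l < len j,
    s((path i).getVert k, (path i).getVert (k + 1)) =
      s((path j).getVert l, (path j).getVert (l + 1)) → i = j ∧ k = l
  /-- every vertex lies on one of the paths -/
  vert_cover : ∀ x, ∃ i, ∃ k ≤ len i, (path i).getVert k = x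
  /-- every edge lies on one of the paths -/
  edge_cover : ∀ x y, G.Adj x y →
    ∃ i, ∃ k < len i, s((path i).getVert k, (path i).getVert (k + 1)) = s(x, y)

/-- `P` holds for the lengths `a, …, f` after one of the symmetric relabellings of the figure:
exchanging `p₁, p₂`, exchanging `p₃, p₄`, exchanging `p₅, p₆` (rename `u ↔ v` and
`u' ↔ v'`), and exchanging `p₁, p₂` with `p₄, p₃` (rename `u ↔ u'` and `v ↔ v'`), in any
combination. -/
def UpToSymmetry (P : ℕ → ℕ → ℕ → ℕ → ℕ → ℕ → Prop) (a b c d e f : ℕ) : Prop :=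
  let P₁ := fun a b c d e f => P a b c d e f ∨ P b a c d e f
  let P₂ := fun a b c d e f => P₁ a b c d e f ∨ P₁ a b d c e f
  let P₃ := fun a b c d e f => P₂ a b c d e f ∨ P₂ a b c d f e
  P₃ a b c d e f ∨ P₃ d c b a e f

/-- The list of lengths for which the value is `1`. -/
def MuOneList (a b c d e f : ℕ) : Prop :=
  (a = 2 ∧ b = 2 ∧ c = 2 ∧ d = 2 ∧ e = 2 ∧ f = 2) ∨
  (a = 2 ∧ b = 2 ∧ e + f = 2 ∧ c = 0 ∧ d = 0) ∨
  (a = 2 ∧ d = 2 ∧ f = 2 ∧ b = 1 ∧ c = 1 ∧ e = 0) ∨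
  (a = 2 ∧ d = 2 ∧ f = 2 ∧ b = 2 ∧ c = 2 ∧ e = 0) ∨
  (a = 2 ∧ b = 2 ∧ c = 2 ∧ d = 2 ∧ e = 0 ∧ f = 0)

/-- The list of lengths for which the value is `3`. The last two lines describe the graphs of the
first two lines (a cycle, and three paths with common end vertices) with other labels. -/
def MuThreeList (a b c d e f : ℕ) : Prop :=
  (a = 0 ∧ b = 0 ∧ c = 0 ∧ d = 0 ∧ e + f ≡ 2 [MOD 4]) ∨
  (b = 1 ∧ c = 0 ∧ d = 0 ∧ a ≡ 1 [MOD 4] ∧ e + f ≡ 1 [MOD 4]) ∨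
  (b = 1 ∧ e = 0 ∧ f = 0 ∧ a ≡ 1 [MOD 4] ∧ c ≡ 1 [MOD 4] ∧ d ≡ 1 [MOD 4]) ∨
  (b = 1 ∧ c = 1 ∧ a ≡ 1 [MOD 4] ∧ d ≡ 1 [MOD 4] ∧ e ≡ 1 [MOD 4] ∧ f ≡ 3 [MOD 4]) ∨
  (a ≡ 2 [MOD 4] ∧ b = 0 ∧ c = 0 ∧ d = 0 ∧ e = 0 ∧ f = 0) ∨
  (c = 0 ∧ d = 0 ∧ e + f = 1 ∧ a ≡ 1 [MOD 4] ∧ b ≡ 1 [MOD 4])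

/-!
Three weights always suffice: in a connected graph with parts `X` and `Y`, the vectors of vertex
sums modulo `3` are exactly those whose sums over `X` and over `Y` agree (`mem_range_vertexSum`).
So the colours can be chosen to be `0` on `X` and nonzero on `Y`, provided that `Y` has two
elements (`exists_isVCEW_three`). As `μ(G)` is at most `k` if and only if there is a weighting
with weights up to `k`, it remains to find out when the weights `{1}` and `{1, 2}` suffice.

A weighting of the figure amounts to six sequences of weights, one for each path. Corners are
labelled so that identified corners share a label, and the constraints can be written in terms of
the lengths alone (`PolygonFigure.exists_isVCEW_iff`). Two adjacent inner vertices of a path have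
different colours if and only if the two edges at distance two around them have different weights.
With weights `1` and `2` each path therefore carries a sequence `s, t, 3 - s, 3 - t, s, …` of
period `4`, determined by its first two terms (`IsPathWeighting.eq_pattern`), and the only
remaining constraints are those at the corners. They depend on each length `n ≥ 2` only modulo `4`
(`isPatternWeighting_lengthClass`), so all lengths may be taken from `{0, …, 5}`. The parity of
the lengths (`PolygonFigure.parity_conditions`) and the absence of parallel edges
(`PolygonFigure.not_hasRepetition`) are all that the weights `{1, 2}` require of the hypotheses
that `G` is simple and bipartite; the weight `1` also needs that no path of length `2` is closed
(`PolygonFigure.cornerLabel_ne_of_length_eq_two`). For the finitely many lengths that are left,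
the kernel runs through the first two weights of all paths (`forallLengths_searchAgrees`). If all
weights are `1`, no path is longer than `2`, and the kernel checks these lengths as well
(`forallLengths_onesAgree`).
-/

/-! ### Three weights suffice for connected bipartite graphs -/

/-- The sum over the neighbours of `v`, read as a sum over all edges. -/
theorem sum_neighborSet_eq_sum_edgeSet {V M : Type*} [Fintype V] [DecidableEq V]
    [AddCommMonoid M] (G : SimpleGraph V) [DecidableRel G.Adj] (w : G.edgeSet → M) (v : V) :
    ∑ x : G.neighborSet v, w ⟨s(v, x.1), x.2⟩ =
      ∑ e : G.edgeSet, if v ∈ (e : Sym2 V) then w e else 0 := by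
  classical
  rw [← Finset.sum_filter]
  refine Finset.sum_bij (fun x _ => ⟨s(v, x.1), x.2⟩) ?_ ?_ ?_ ?_
  · intro x _
    simp
  · intro x _ y _ h
    have h' : s(v, x.1) = s(v, y.1) := congrArg Subtype.val h
    rcases Sym2.eq_iff.1 h' with h' | h'
    · exact Subtype.ext h'.2
    · exact Subtype.ext (h'.2.trans h'.1)
  · rintro ⟨e, he⟩ hv
    obtain ⟨-, hv⟩ := Finset.mem_filter.1 hv
    obtain ⟨y, rfl⟩ := Sym2.mem_iff_exists.1 hv
    exact ⟨⟨y, he⟩, Finset.mem_univ _, rfl⟩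
  · intro x _
    rfl

/-- The linear map that sends an edge weighting with values in `R` to its vertex sums. -/
def vertexSum {V : Type*} [Fintype V] [DecidableEq V] (R : Type*) [CommRing R]
    (G : SimpleGraph V) [DecidableRel G.Adj] : (G.edgeSet → R) →ₗ[R] (V → R) where
  toFun w v := ∑ e : G.edgeSet, if v ∈ (e : Sym2 V) then w e else 0
  map_add' w w' := by
    ext v
    simp only [Pi.add_apply, ← Finset.sum_add_distrib]
    exact Finset.sum_congr rfl fun e _ => by split_ifs <;> simp
  map_smul' r w := by
    ext v
    simp [Finset.mul_sum]

theorem single_add_single_mem_range_vertexSum {V R : Type*} [Fintype V] [DecidableEq V]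
    [CommRing R] {G : SimpleGraph V} [DecidableRel G.Adj] {x y : V} (h : G.Adj x y) :
    Pi.single x 1 + Pi.single y 1 ∈ LinearMap.range (vertexSum R G) := by
  refine ⟨Pi.single ⟨s(x, y), h⟩ 1, ?_⟩
  ext v
  have : ∀ e : G.edgeSet, (if v ∈ (e : Sym2 V) then
      (Pi.single ⟨s(x, y), h⟩ 1 : G.edgeSet → R) e else 0) =
      if e = ⟨s(x, y), h⟩ then (if v ∈ s(x, y) then 1 else 0) else 0 := by
    intro e
    by_cases he : e = ⟨s(x, y), h⟩
    · subst he; simp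
    · simp [he]
  refine (Finset.sum_congr rfl fun e _ => this e).trans ?_
  simp only [Finset.sum_ite_eq', Finset.mem_univ, if_true, Pi.add_apply, Pi.single_apply,
    Sym2.mem_iff]
  by_cases hx : v = x
  · have : v ≠ y := hx ▸ h.ne
    simp [hx, h.ne]
  · simp [hx]

/-- In a connected graph with a `±1`-valued function `ε` that changes sign along every edge, every
vector `t` with `∑ ε v * t v = 0` consists of the vertex sums of an edge weighting: modulo the
vertex sums, all vectors `ε v • Pi.single v 1` agree. -/
theorem mem_range_vertexSum {V R : Type*} [Fintype V] [DecidableEq V] [CommRing R]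
    {G : SimpleGraph V} [DecidableRel G.Adj] (hc : G.Connected) (ε : V → R)
    (hε : ∀ v, ε v * ε v = 1) (hadj : ∀ x y, G.Adj x y → ε x = -ε y) (t : V → R)
    (ht : ∑ v, ε v * t v = 0) : t ∈ LinearMap.range (vertexSum R G) := by
  obtain ⟨r⟩ := hc.nonempty
  have key : ∀ v, Pi.single v (ε v) - Pi.single r (ε r) ∈ LinearMap.range (vertexSum R G) := by
    intro v
    obtain ⟨p⟩ := hc.preconnected v r
    induction p with
    | nil => simp
    | @cons x y z hxy p ih =>
      have h := Submodule.smul_mem _ (ε x) (single_add_single_mem_range_vertexSum (R := R) hxy)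
      have := Submodule.add_mem _ h ih
      convert this using 1
      rw [hadj x y hxy, smul_add, ← Pi.single_smul, ← Pi.single_smul, smul_eq_mul, mul_one,
        Pi.single_neg, Pi.single_neg]
      abel
  have : t = ∑ v, (ε v * t v) • (Pi.single v (ε v) - Pi.single r (ε r)) := by
    simp only [smul_sub, Finset.sum_sub_distrib, ← Finset.sum_smul, ht, zero_smul, sub_zero]
    ext u
    simp only [Finset.sum_apply, Pi.smul_apply, Pi.single_apply, smul_eq_mul, mul_ite, mul_zero,
      Finset.sum_ite_eq, Finset.mem_univ, if_true]
    linear_combination -(t u) * hε u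
  rw [this]
  exact Submodule.sum_mem _ fun v _ => Submodule.smul_mem _ _ (key v)

/-- A set with at least two elements carries nowhere vanishing residues modulo `3` with sum `0`:
the two residues on distinguished elements can be adjusted freely. -/
theorem exists_ne_zero_sum_eq_zero {V : Type*} [DecidableEq V] (s : Finset V)
    (hs : 1 < s.card) : ∃ t : V → ZMod 3, (∀ v ∈ s, t v ≠ 0) ∧ ∑ v ∈ s, t v = 0 := by
  obtain ⟨x, hx, y, hy, hxy⟩ := Finset.one_lt_card.1 hs
  have two : ∀ r : ZMod 3, ∃ p q : ZMod 3, p ≠ 0 ∧ q ≠ 0 ∧ p + (q + r) = 0 := by decide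
  obtain ⟨p, q, hp, hq, hr⟩ := two (∑ v ∈ (s.erase x).erase y, 1)
  refine ⟨fun v => if v = x then p else if v = y then q else 1, ?_, ?_⟩
  · intro v _
    dsimp only
    split_ifs
    exacts [hp, hq, one_ne_zero]
  · have hy' : y ∈ s.erase x := Finset.mem_erase.2 ⟨hxy.symm, hy⟩
    rw [← Finset.add_sum_erase s _ hx, ← Finset.add_sum_erase _ _ hy', if_pos rfl,
      if_neg hxy.symm, if_pos rfl]
    convert hr using 3
    refine Finset.sum_congr rfl fun v hv => ?_
    simp only [Finset.mem_erase] at hv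
    rw [if_neg hv.2.1, if_neg hv.1]

/-- Colour one part of a connected bipartite graph by `0` and the other one by `1` and `2` modulo
`3`, with sum `0` over the second part. Such colours come from weights modulo `3`. -/
theorem exists_isVCEW_three {V : Type*} [Fintype V] (G : SimpleGraph V) [DecidableRel G.Adj]
    (hV : 3 ≤ Fintype.card V) (hc : G.Connected) (κ : G.Coloring Bool) :
    ∃ w, IsVCEW G 3 w := by
  classical
  -- one of the two parts has at least two vertices
  obtain ⟨β, hβ⟩ : ∃ β, 1 < (Finset.univ.filter fun v => κ v = β).card := by
    obtain ⟨β, -, hβ⟩ := Finset.exists_lt_card_fiber_of_mul_lt_card_of_maps_to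
      (s := (Finset.univ : Finset V)) (t := (Finset.univ : Finset Bool)) (f := κ) (n := 1)
      (fun _ _ => Finset.mem_univ _) (by simpa using by omega)
    exact ⟨β, hβ⟩
  obtain ⟨t, ht0, hts⟩ := exists_ne_zero_sum_eq_zero _ hβ
  have hmem : (fun v => if κ v = β then t v else 0) ∈ LinearMap.range (vertexSum (ZMod 3) G) := by
    refine mem_range_vertexSum hc (fun v => if κ v = β then 1 else -1) ?_ ?_ _ ?_
    · intro v
      split_ifs <;> simp
    · intro x y h
      have := κ.valid h
      split_ifs with h1 h2 h2
      · exact absurd (h1.trans h2.symm) this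
      · simp
      · simp
      · exact absurd ((Bool.eq_not_of_ne h1).trans (Bool.eq_not_of_ne h2).symm) this
    · refine Eq.trans ?_ hts
      rw [Finset.sum_filter]
      refine Finset.sum_congr rfl fun v _ => ?_
      split_ifs <;> simp
  obtain ⟨w, hw⟩ := hmem
  -- the representatives in `{1, 2, 3}` of the residues modulo `3`
  have lift : ∀ z : ZMod 3, ∃ n : ℕ, (1 ≤ n ∧ n ≤ 3) ∧ (n : ZMod 3) = z := by
    intro z
    fin_cases z
    exacts [⟨3, by norm_num, rfl⟩, ⟨1, by norm_num, rfl⟩, ⟨2, by norm_num, rfl⟩]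
  choose n hn hnz using lift
  have hcol : ∀ v, (inducedColor G (fun e => n (w e)) v : ZMod 3) =
      if κ v = β then t v else 0 := by
    intro v
    rw [inducedColor, Nat.cast_sum, ← congrFun hw v]
    simp only [hnz]
    exact sum_neighborSet_eq_sum_edgeSet G w v
  refine ⟨fun e => n (w e), fun e => hn _, fun x y h heq => ?_⟩
  have h1 := hcol x
  rw [heq, hcol y] at h1
  have hxy := κ.valid h
  by_cases hx : κ x = β
  · have hy : κ y ≠ β := fun h => hxy (hx.trans h.symm)
    rw [if_pos hx, if_neg hy] at h1
    exact ht0 x (by simp [hx]) h1.symm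
  · have hy : κ y = β := by
      by_contra hy
      exact hxy ((Bool.eq_not_of_ne hx).trans (Bool.eq_not_of_ne hy).symm)
    rw [if_neg hx, if_pos hy] at h1
    exact ht0 y (by simp [hy]) h1

/-! ### Weightings of a polygon figure, path by path -/

namespace PolygonFigure

variable {V : Type*} {G : SimpleGraph V} {L : Fin 6 → ℕ} (F : PolygonFigure G L)

/-- The edges of the figure: the pair of `i` and `k` stands for the `k`-th edge of the `i`-th path,
counted from `0`. -/
def edge (p : Σ i, Fin (L i)) : G.edgeSet :=
  ⟨s((F.path p.1).getVert p.2, (F.path p.1).getVert (p.2 + 1)),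
    (F.path p.1).adj_getVert_succ (by rw [F.length_path]; exact p.2.2)⟩

theorem edge_bijective : Function.Bijective F.edge := by
  constructor
  · rintro ⟨i, k, hk⟩ ⟨j, l, hl⟩ h
    obtain ⟨rfl, rfl⟩ := F.edge_inj i j k hk l hl (congrArg Subtype.val h)
    rfl
  · rintro ⟨e, he⟩
    induction e with
    | _ x y =>
      obtain ⟨i, k, hk, h⟩ := F.edge_cover x y he
      exact ⟨⟨i, k, hk⟩, Subtype.ext h⟩

theorem getVert_zero (i : Fin 6) : (F.path i).getVert 0 = F.corner (pathStart i) :=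
  (F.path i).getVert_zero

theorem getVert_length (i : Fin 6) : (F.path i).getVert (L i) = F.corner (pathEnd i) := by
  rw [← F.length_path i]
  exact (F.path i).getVert_length

theorem corner_eq_of_length_eq_zero {i : Fin 6} (h : L i = 0) :
    F.corner (pathStart i) = F.corner (pathEnd i) :=
  SimpleGraph.Walk.eq_of_length_eq_zero ((F.length_path i).trans h)

theorem getVert_ne_getVert_succ {i : Fin 6} {k : ℕ} (hk : k < L i) :
    (F.path i).getVert k ≠ (F.path i).getVert (k + 1) :=
  ((F.path i).adj_getVert_succ (by rw [F.length_path]; exact hk)).ne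

theorem corner_eq_getVert_iff {i : Fin 6} {k : ℕ} (hk : k < L i) (x : Fin 4) :
    F.corner x = (F.path i).getVert k ↔ k = 0 ∧ F.corner x = F.corner (pathStart i) := by
  rcases Nat.eq_zero_or_pos k with rfl | h0
  · simp [F.getVert_zero]
  · exact ⟨fun h => absurd h.symm (F.inner_ne_corner i k hk h0 x), fun h => absurd h.1 h0.ne'⟩

theorem corner_eq_getVert_succ_iff {i : Fin 6} {k : ℕ} (hk : k < L i) (x : Fin 4) :
    F.corner x = (F.path i).getVert (k + 1) ↔
      k + 1 = L i ∧ F.corner x = F.corner (pathEnd i) := by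
  rcases Nat.lt_or_ge (k + 1) (L i) with h0 | h0
  · exact ⟨fun h => absurd h.symm (F.inner_ne_corner i _ h0 k.succ_pos x),
      fun h => absurd h.1 h0.ne⟩
  · have h : k + 1 = L i := le_antisymm hk h0
    rw [h, F.getVert_length]
    simp

theorem getVert_eq_getVert_iff {i j : Fin 6} {k l : ℕ} (hk : k < L i) (hk0 : 0 < k)
    (hl : l ≤ L j) : (F.path i).getVert k = (F.path j).getVert l ↔ j = i ∧ l = k := by
  constructor
  · intro h
    rcases Nat.eq_zero_or_pos l with rfl | h0
    · rw [F.getVert_zero] at h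
      exact absurd h (F.inner_ne_corner i k hk hk0 _)
    rcases hl.lt_or_eq with hl | rfl
    · obtain ⟨rfl, rfl⟩ := F.inner_inj i j k hk l hl hk0 h0 h
      exact ⟨rfl, rfl⟩
    · rw [F.getVert_length] at h
      exact absurd h (F.inner_ne_corner i k hk hk0 _)
  · rintro ⟨rfl, rfl⟩
    rfl

theorem exists_walk_corner_zero : ∀ x : Fin 4, Nonempty (G.Walk (F.corner 0) (F.corner x)) := by
  have h01 : G.Walk (F.corner 0) (F.corner 1) := F.path 0
  have h02 : G.Walk (F.corner 0) (F.corner 2) := F.path 4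
  have h23 : G.Walk (F.corner 2) (F.corner 3) := F.path 2
  intro x
  fin_cases x
  exacts [⟨.nil⟩, ⟨h01⟩, ⟨h02⟩, ⟨h02.append h23⟩]

theorem connected (F : PolygonFigure G L) : G.Connected := by
  have h : ∀ x, G.Reachable (F.corner 0) x := by
    intro x
    obtain ⟨i, k, -, rfl⟩ := F.vert_cover x
    exact (F.exists_walk_corner_zero (pathStart i)).elim fun p =>
      ⟨p.append ((F.path i).take k)⟩
  exact (SimpleGraph.connected_iff_exists_forall_reachable G).2 ⟨_, h⟩

variable [Fintype V] [DecidableRel G.Adj]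

/-- The edges at `v` are those that have `v` as their first or second vertex along their path. -/
theorem inducedColor_eq [DecidableEq V] (w : G.edgeSet → ℕ) (W : Fin 6 → ℕ → ℕ)
    (hW : ∀ i k (h : k < L i), w (F.edge ⟨i, k, h⟩) = W i k) (v : V) :
    inducedColor G w v = ∑ i, ∑ k ∈ Finset.range (L i),
      ((if v = (F.path i).getVert k then W i k else 0) +
        if v = (F.path i).getVert (k + 1) then W i k else 0) := by
  rw [inducedColor, sum_neighborSet_eq_sum_edgeSet, ← F.edge_bijective.sum_comp,
    Fintype.sum_sigma]
  refine Finset.sum_congr rfl fun i _ => ?_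
  rw [Finset.sum_range]
  refine Finset.sum_congr rfl fun k _ => ?_
  rw [← hW i k k.2]
  have := F.getVert_ne_getVert_succ k.2
  simp only [edge, Sym2.mem_iff]
  by_cases h1 : v = (F.path i).getVert k
  · have h2 : v ≠ (F.path i).getVert (k + 1) := h1 ▸ this
    simp [h1, this]
  · simp [h1]

theorem inducedColor_getVert [DecidableEq V] (w : G.edgeSet → ℕ) (W : Fin 6 → ℕ → ℕ)
    (hW : ∀ i k (h : k < L i), w (F.edge ⟨i, k, h⟩) = W i k) {i : Fin 6} {k : ℕ}
    (hk : k + 1 < L i) :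
    inducedColor G w ((F.path i).getVert (k + 1)) = W i k + W i (k + 1) := by
  rw [F.inducedColor_eq w W hW]
  have h : ∀ j, ∑ l ∈ Finset.range (L j),
      ((if (F.path i).getVert (k + 1) = (F.path j).getVert l then W j l else 0) +
        if (F.path i).getVert (k + 1) = (F.path j).getVert (l + 1) then W j l else 0) =
      if j = i then W i k + W i (k + 1) else 0 := by
    intro j
    have h1 : ∀ l ∈ Finset.range (L j),
        ((if (F.path i).getVert (k + 1) = (F.path j).getVert l then W j l else 0) +
          if (F.path i).getVert (k + 1) = (F.path j).getVert (l + 1) then W j l else 0) =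
        (if j = i ∧ l = k + 1 then W j l else 0) + if j = i ∧ l = k then W j l else 0 := by
      intro l hl
      have hl := Finset.mem_range.1 hl
      simp only [F.getVert_eq_getVert_iff hk k.succ_pos hl.le,
        F.getVert_eq_getVert_iff hk k.succ_pos hl, Nat.succ_eq_add_one, Nat.add_right_cancel_iff]
    rw [Finset.sum_congr rfl h1]
    by_cases hj : j = i
    · subst hj
      have hk' : k < L j := by omega
      simp [Finset.sum_add_distrib, hk, hk', add_comm]
    · simp [hj]
  simp [h]

end PolygonFigure

/-- The colour of the corners with label `x`, if the `k`-th edge of the `i`-th path has the weight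
`W i k`. Here `l` labels the corners, identified ones by the same number. -/
def cornerColor (L : Fin 6 → ℕ) (l : Fin 4 → ℕ) (W : Fin 6 → ℕ → ℕ) (x : ℕ) : ℕ :=
  ∑ i, if L i = 0 then 0 else
    (if l (pathStart i) = x then W i 0 else 0) + if l (pathEnd i) = x then W i (L i - 1) else 0

/-- The colour of the `k`-th vertex of the `i`-th path. -/
def positionColor (L : Fin 6 → ℕ) (l : Fin 4 → ℕ) (W : Fin 6 → ℕ → ℕ) (i : Fin 6) (k : ℕ) : ℕ :=
  if k = 0 then cornerColor L l W (l (pathStart i))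
  else if k = L i then cornerColor L l W (l (pathEnd i))
  else W i (k - 1) + W i k

/-- `W` describes, path by path, a vertex-coloring `K`-edge-weighting of a figure with the lengths
`L` and the corner labels `l`. -/
def IsPathWeighting (L : Fin 6 → ℕ) (l : Fin 4 → ℕ) (K : ℕ) (W : Fin 6 → ℕ → ℕ) : Prop :=
  ∀ i, ∀ k < L i, (1 ≤ W i k ∧ W i k ≤ K) ∧
    positionColor L l W i k ≠ positionColor L l W i (k + 1)

namespace PolygonFigure

variable {V : Type*} {G : SimpleGraph V} {L : Fin 6 → ℕ} (F : PolygonFigure G L)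
  [Fintype V] [DecidableRel G.Adj]

theorem inducedColor_corner {l : Fin 4 → ℕ} (hl : ∀ x y, l x = l y ↔ F.corner x = F.corner y)
    (w : G.edgeSet → ℕ) (W : Fin 6 → ℕ → ℕ)
    (hW : ∀ i k (h : k < L i), w (F.edge ⟨i, k, h⟩) = W i k) (x : Fin 4) :
    inducedColor G w (F.corner x) = cornerColor L l W (l x) := by
  classical
  rw [F.inducedColor_eq w W hW, cornerColor]
  refine Finset.sum_congr rfl fun i _ => ?_
  rcases Nat.eq_zero_or_pos (L i) with h0 | h0
  · simp [h0]
  have h1 : ∀ k ∈ Finset.range (L i),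
      ((if F.corner x = (F.path i).getVert k then W i k else 0) +
        if F.corner x = (F.path i).getVert (k + 1) then W i k else 0) =
      (if k = 0 then (if l (pathStart i) = l x then W i k else 0) else 0) +
        if k = L i - 1 then (if l (pathEnd i) = l x then W i k else 0) else 0 := by
    intro k hk
    have hk := Finset.mem_range.1 hk
    have h2 : k + 1 = L i ↔ k = L i - 1 := by omega
    simp only [F.corner_eq_getVert_iff hk, F.corner_eq_getVert_succ_iff hk, ← hl, h2, ite_and,
      eq_comm (a := l x)]
  rw [Finset.sum_congr rfl h1, Finset.sum_add_distrib, Finset.sum_ite_eq', Finset.sum_ite_eq',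
    if_pos (Finset.mem_range.2 h0), if_pos (Finset.mem_range.2 (by omega)), if_neg h0.ne']

theorem inducedColor_eq_positionColor {l : Fin 4 → ℕ}
    (hl : ∀ x y, l x = l y ↔ F.corner x = F.corner y) (w : G.edgeSet → ℕ) (W : Fin 6 → ℕ → ℕ)
    (hW : ∀ i k (h : k < L i), w (F.edge ⟨i, k, h⟩) = W i k) {i : Fin 6} {k : ℕ}
    (hk : k ≤ L i) :
    inducedColor G w ((F.path i).getVert k) = positionColor L l W i k := by
  classical
  rw [positionColor]
  split_ifs with h0 h1
  · rw [h0, F.getVert_zero, F.inducedColor_corner hl w W hW]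
  · rw [h1, F.getVert_length, F.inducedColor_corner hl w W hW]
  · obtain ⟨k, rfl⟩ := Nat.exists_eq_succ_of_ne_zero h0
    exact F.inducedColor_getVert w W hW (by omega)

theorem exists_isVCEW_iff {l : Fin 4 → ℕ} (hl : ∀ x y, l x = l y ↔ F.corner x = F.corner y)
    (K : ℕ) : (∃ w, IsVCEW G K w) ↔ ∃ W, IsPathWeighting L l K W := by
  constructor
  · rintro ⟨w, hw, hadj⟩
    have hW : ∀ i k (h : k < L i), w (F.edge ⟨i, k, h⟩) =
        if h : k < L i then w (F.edge ⟨i, k, h⟩) else 0 := fun i k h => by rw [dif_pos h]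
    refine ⟨fun i k => if h : k < L i then w (F.edge ⟨i, k, h⟩) else 0, fun i k hk => ?_⟩
    dsimp only
    rw [← F.inducedColor_eq_positionColor hl w _ hW hk.le,
      ← F.inducedColor_eq_positionColor hl w _ hW hk, dif_pos hk]
    exact ⟨hw _, hadj _ _ (F.edge ⟨i, k, hk⟩).2⟩
  · rintro ⟨W, hW⟩
    let Φ := Equiv.ofBijective F.edge F.edge_bijective
    have hw : ∀ i k (h : k < L i), W (Φ.symm (F.edge ⟨i, k, h⟩)).1 (Φ.symm (F.edge ⟨i, k, h⟩)).2 =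
        W i k := by
      intro i k h
      have : Φ.symm (F.edge ⟨i, k, h⟩) = ⟨i, k, h⟩ := Φ.symm_apply_apply _
      rw [this]
    refine ⟨fun e => W (Φ.symm e).1 (Φ.symm e).2, fun e => (hW _ _ (Φ.symm e).2.2).1, ?_⟩
    intro x y hxy
    obtain ⟨i, k, hk, h⟩ := F.edge_cover x y hxy
    have hne : inducedColor G (fun e => W (Φ.symm e).1 (Φ.symm e).2) ((F.path i).getVert k) ≠
        inducedColor G (fun e => W (Φ.symm e).1 (Φ.symm e).2) ((F.path i).getVert (k + 1)) := by
      rw [F.inducedColor_eq_positionColor hl _ W hw hk.le,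
        F.inducedColor_eq_positionColor hl _ W hw hk]
      exact (hW i k hk).2
    rcases Sym2.eq_iff.1 h with ⟨rfl, rfl⟩ | ⟨rfl, rfl⟩
    exacts [hne, hne.symm]

end PolygonFigure

/-- The labelling `l` of the corners after the two ends of the `i`-th path are identified, if this
path has length `0`. -/
def mergeEnds (L : Fin 6 → ℕ) (l : Fin 4 → Fin 4) (i : Fin 6) : Fin 4 → Fin 4 :=
  fun x => if L i = 0 ∧ l x = l (pathEnd i) then l (pathStart i) else l x

/-- A labelling of the corners under which the corners that are linked by paths of length `0`, and
no others, have the same label. -/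
def cornerLabel (L : Fin 6 → ℕ) : Fin 4 → Fin 4 :=
  (List.finRange 6).foldl (mergeEnds L) id

theorem mergeEnds_eq_of_eq {L : Fin 6 → ℕ} {l : Fin 4 → Fin 4} {x y : Fin 4} (h : l x = l y)
    (i : Fin 6) : mergeEnds L l i x = mergeEnds L l i y := by
  simp [mergeEnds, h]

theorem foldl_mergeEnds_eq_of_eq {L : Fin 6 → ℕ} {x y : Fin 4} (t : List (Fin 6)) :
    ∀ l : Fin 4 → Fin 4, l x = l y → t.foldl (mergeEnds L) l x = t.foldl (mergeEnds L) l y := by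
  induction t with
  | nil => exact fun _ h => h
  | cons i t ih => exact fun l h => ih _ (mergeEnds_eq_of_eq h i)

theorem foldl_mergeEnds_pathStart {L : Fin 6 → ℕ} {i : Fin 6} (hi : L i = 0)
    (t : List (Fin 6)) (l : Fin 4 → Fin 4) (ht : i ∈ t) :
    t.foldl (mergeEnds L) l (pathStart i) = t.foldl (mergeEnds L) l (pathEnd i) := by
  induction t generalizing l with
  | nil => simp at ht
  | cons j t ih =>
    rcases List.mem_cons.1 ht with rfl | ht
    · refine foldl_mergeEnds_eq_of_eq t _ ?_
      simp [mergeEnds, hi]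
    · exact ih _ ht

/-- A function on the corners that respects the identifications factors through the labelling. -/
theorem apply_foldl_mergeEnds {α : Type*} {L : Fin 6 → ℕ} {φ : Fin 4 → α}
    (hφ : ∀ i, L i = 0 → φ (pathStart i) = φ (pathEnd i)) (t : List (Fin 6)) :
    ∀ l : Fin 4 → Fin 4, (∀ x, φ (l x) = φ x) → ∀ x, φ (t.foldl (mergeEnds L) l x) = φ x := by
  induction t with
  | nil => exact fun _ h => h
  | cons i t ih =>
    refine fun l hl => ih _ fun x => ?_
    rw [mergeEnds]
    split_ifs with h
    · rw [hl, hφ i h.1, ← hl (pathEnd i), ← h.2, hl]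
    · exact hl x

theorem PolygonFigure.cornerLabel_eq_iff {V : Type*} {G : SimpleGraph V} {L : Fin 6 → ℕ}
    (F : PolygonFigure G L) (x y : Fin 4) :
    (cornerLabel L x : ℕ) = cornerLabel L y ↔ F.corner x = F.corner y := by
  rw [Fin.val_inj]
  constructor
  · intro h
    have hs := apply_foldl_mergeEnds (φ := F.corner)
      (fun i hi => F.corner_eq_of_length_eq_zero hi) (List.finRange 6) id fun _ => rfl
    rw [← hs x, ← hs y]
    exact congrArg F.corner h
  · intro h
    have h' := F.corner_eq x y h
    clear h
    induction h' with
    | rel s t hst =>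
      obtain ⟨i, hi, rfl, rfl⟩ := hst
      exact foldl_mergeEnds_pathStart hi _ _ (List.mem_finRange i)
    | refl => rfl
    | symm _ _ _ ih => exact ih.symm
    | trans _ _ _ _ _ ih₁ ih₂ => exact ih₁.trans ih₂

/-! ### Weights one and two: reduction to bounded lengths -/

/-- The sequence `s, t, 3 - s, 3 - t, s, t, …` of period `4`. -/
def pattern (s t k : ℕ) : ℕ :=
  match k % 4 with
  | 0 => s
  | 1 => t
  | 2 => 3 - s
  | _ => 3 - t

/-- The possible first two weights of a path of length `n`. A weight of an edge that does not exist
is taken to be `1`. The order of the lists keeps the searches through them short. -/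
def startWeights : ℕ → List (ℕ × ℕ)
  | 0 => [(1, 1)]
  | 1 => [(2, 1), (1, 1)]
  | _ => [(2, 1), (1, 2), (1, 1), (2, 2)]

/-- Whether the weights `pattern s t` on a path of length `n` give each end of the path, with
colours `p` and `q`, another colour than the neighbouring vertex of the path. -/
def endsCompatible (n s t p q : ℕ) : Bool :=
  match n with
  | 0 => true
  | 1 => !p.beq q
  | n + 2 => !p.beq (s + t) && !(pattern s t n + pattern s t (n + 1)).beq q

/-- The colour of the corners with label `x`, if the `i`-th path has the weights
`pattern (s i) (t i)`. -/
def patternCornerColor (L : Fin 6 → ℕ) (l : Fin 4 → ℕ) (s t : Fin 6 → ℕ) (x : ℕ) : ℕ :=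
  cornerColor L l (fun i => pattern (s i) (t i)) x

/-- The weights `pattern (s i) (t i)` of the paths, with all `s i` and `t i` in `{1, 2}`, form a
vertex-coloring `2`-edge-weighting. -/
def IsPatternWeighting (L : Fin 6 → ℕ) (l : Fin 4 → ℕ) (s t : Fin 6 → ℕ) : Prop :=
  ∀ i, (s i, t i) ∈ startWeights (L i) ∧
    endsCompatible (L i) (s i) (t i) (patternCornerColor L l s t (l (pathStart i)))
      (patternCornerColor L l s t (l (pathEnd i))) = true

theorem pattern_zero (s t : ℕ) : pattern s t 0 = s := rfl

theorem pattern_one (s t : ℕ) : pattern s t 1 = t := rfl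

theorem pattern_mod_four (s t k : ℕ) : pattern s t (k % 4) = pattern s t k := by
  simp [pattern]

theorem pattern_add_two {s t : ℕ} (hs : s ≤ 3) (ht : t ≤ 3) (k : ℕ) :
    pattern s t (k + 2) = 3 - pattern s t k := by
  rw [← pattern_mod_four, ← pattern_mod_four s t k, Nat.add_mod]
  have : k % 4 < 4 := Nat.mod_lt _ (by norm_num)
  interval_cases k % 4 <;> simp [pattern] <;> omega

theorem pattern_mem {s t : ℕ} (hs : 1 ≤ s ∧ s ≤ 2) (ht : 1 ≤ t ∧ t ≤ 2) (k : ℕ) :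
    1 ≤ pattern s t k ∧ pattern s t k ≤ 2 := by
  rw [pattern]
  split <;> omega

theorem mem_startWeights {n s t : ℕ} :
    (s, t) ∈ startWeights n ↔ (1 ≤ s ∧ s ≤ 2) ∧ (1 ≤ t ∧ t ≤ 2) ∧ (n = 0 → s = 1) ∧
      (n ≤ 1 → t = 1) := by
  rcases n with _ | _ | n <;> simp [startWeights] <;> omega

theorem not_beq_eq_true {p q : ℕ} : (!p.beq q) = true ↔ p ≠ q := by
  rw [Bool.not_eq_true', ← Bool.not_eq_true, Nat.beq_eq]

theorem endsCompatible_one {s t p q : ℕ} : endsCompatible 1 s t p q = true ↔ p ≠ q := by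
  rw [endsCompatible, not_beq_eq_true]

theorem endsCompatible_add_two {n s t p q : ℕ} :
    endsCompatible (n + 2) s t p q = true ↔
      p ≠ s + t ∧ pattern s t n + pattern s t (n + 1) ≠ q := by
  rw [endsCompatible, Bool.and_eq_true, not_beq_eq_true, not_beq_eq_true]

theorem cornerColor_congr {L : Fin 6 → ℕ} {W W' : Fin 6 → ℕ → ℕ}
    (h : ∀ i, ∀ k < L i, W i k = W' i k) (l : Fin 4 → ℕ) (x : ℕ) :
    cornerColor L l W x = cornerColor L l W' x := by
  refine Finset.sum_congr rfl fun i _ => ?_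
  split_ifs with h0 <;> first | rfl | rw [h i 0 (by omega)] | skip
  all_goals first | rw [h i (L i - 1) (by omega)]

/-- Adjacent inner vertices of a path have different colours if and only if edges at distance two
have different weights. Hence two weights are determined by the first two weights of each path. -/
theorem IsPathWeighting.eq_pattern {L : Fin 6 → ℕ} {l : Fin 4 → ℕ} {W : Fin 6 → ℕ → ℕ}
    (h : IsPathWeighting L l 2 W) {i : Fin 6} :
    ∀ k < L i, W i k = pattern (W i 0) (if L i ≤ 1 then 1 else W i 1) k := by
  intro k
  induction k using Nat.twoStepInduction with
  | zero => exact fun _ => rfl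
  | one =>
    intro h1
    rw [pattern_one, if_neg (by omega)]
  | more k ih _ =>
    intro hk
    have h0 := h i 0 (by omega)
    have h1 := h i 1 (by omega)
    have h2 := h i k (by omega)
    have h3 := h i (k + 1) (by omega)
    have h4 := h i (k + 2) hk
    have hne := h3.2
    rw [positionColor, positionColor, if_neg (by omega), if_neg (by omega), if_neg (by omega),
      if_neg (by omega), Nat.add_sub_cancel, Nat.add_sub_cancel] at hne
    rw [pattern_add_two (by omega) (by split_ifs <;> omega), ← ih (by omega)]
    rw [show k + 1 + 1 = k + 2 from rfl] at hne
    omega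

theorem IsPathWeighting.isPatternWeighting {L : Fin 6 → ℕ} {l : Fin 4 → ℕ} {W : Fin 6 → ℕ → ℕ}
    (h : IsPathWeighting L l 2 W) :
    IsPatternWeighting L l (fun i => if L i = 0 then 1 else W i 0)
      (fun i => if L i ≤ 1 then 1 else W i 1) := by
  have heq : ∀ i, ∀ k < L i, W i k =
      pattern (if L i = 0 then 1 else W i 0) (if L i ≤ 1 then 1 else W i 1) k := by
    intro i k hk
    rw [if_neg (by omega : L i ≠ 0)]
    exact h.eq_pattern k hk
  have hcol := fun x => cornerColor_congr heq l x
  intro i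
  simp only [patternCornerColor, ← hcol]
  constructor
  · rw [mem_startWeights]
    refine ⟨?_, ?_, fun h0 => if_pos h0, fun h1 => if_pos h1⟩
    · split_ifs with h0
      · omega
      · exact (h i 0 (by omega)).1
    · split_ifs with h0
      · omega
      · exact (h i 1 (by omega)).1
  · obtain hL | hL | ⟨n, hL⟩ : L i = 0 ∨ L i = 1 ∨ ∃ n, L i = n + 2 := by
      rcases L i with _ | _ | n <;> simp
    · simp [hL, endsCompatible]
    · have := (h i 0 (by omega)).2
      simp only [positionColor, hL] at this
      rw [hL, endsCompatible_one]
      simpa using this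
    · rw [hL, endsCompatible_add_two]
      have h0 := (h i 0 (by omega)).2
      have h1 := (h i (n + 1) (by omega)).2
      have e0 := heq i n (by omega)
      have e1 := heq i (n + 1) (by omega)
      simp only [positionColor, hL] at h0 h1
      rw [hL] at e0 e1
      rw [← e0, ← e1]
      constructor
      · simpa using h0
      · simpa using h1

theorem IsPatternWeighting.isPathWeighting {L : Fin 6 → ℕ} {l : Fin 4 → ℕ} {s t : Fin 6 → ℕ}
    (h : IsPatternWeighting L l s t) :
    IsPathWeighting L l 2 fun i => pattern (s i) (t i) := by
  intro i k hk
  obtain ⟨hst, hc⟩ := h i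
  obtain ⟨hs, ht, -, -⟩ := mem_startWeights.1 hst
  refine ⟨pattern_mem hs ht k, ?_⟩
  simp only [patternCornerColor] at hc
  obtain hL | ⟨n, hL⟩ : L i = 1 ∨ ∃ n, L i = n + 2 := by
    rcases hL : L i with _ | _ | n
    · omega
    · exact Or.inl rfl
    · exact Or.inr ⟨n, rfl⟩
  · rw [hL, endsCompatible_one] at hc
    obtain rfl : k = 0 := by omega
    simpa [positionColor, hL] using hc
  · rw [hL, endsCompatible_add_two] at hc
    rcases Nat.eq_zero_or_pos k with rfl | h0
    · simpa [positionColor, hL, pattern_zero, pattern_one] using hc.1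
    rw [positionColor, positionColor, if_neg h0.ne', if_neg hk.ne, if_neg k.succ_ne_zero,
      Nat.add_sub_cancel]
    obtain ⟨k, rfl⟩ := Nat.exists_eq_succ_of_ne_zero h0.ne'
    rw [Nat.succ_eq_add_one, Nat.add_sub_cancel]
    split_ifs with h1
    · obtain rfl : k = n := by omega
      exact hc.2
    · rw [pattern_add_two (by omega) (by omega)]
      have := pattern_mem hs ht k
      omega

theorem exists_isPathWeighting_two_iff {L : Fin 6 → ℕ} {l : Fin 4 → ℕ} :
    (∃ W, IsPathWeighting L l 2 W) ↔ ∃ s t, IsPatternWeighting L l s t :=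
  ⟨fun ⟨_, h⟩ => ⟨_, _, h.isPatternWeighting⟩, fun ⟨_, _, h⟩ => ⟨_, h.isPathWeighting⟩⟩

/-- If all weights are `1`, adjacent inner vertices of a path have the same colour, so no path
has two of them. -/
theorem exists_isPathWeighting_one_iff {L : Fin 6 → ℕ} {l : Fin 4 → ℕ} :
    (∃ W, IsPathWeighting L l 1 W) ↔ (∀ i, L i ≤ 2) ∧ IsPatternWeighting L l 1 1 := by
  constructor
  · rintro ⟨W, h⟩
    have h2 : IsPathWeighting L l 2 W := fun i k hk =>
      ⟨⟨(h i k hk).1.1, (h i k hk).1.2.trans one_le_two⟩, (h i k hk).2⟩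
    have h1 : ∀ i, ∀ k < L i, W i k = 1 := fun i k hk =>
      le_antisymm (h i k hk).1.2 (h i k hk).1.1
    constructor
    · intro i
      by_contra hi
      have := h2.eq_pattern (i := i) 2 (by omega)
      rw [h1 i 0 (by omega), h1 i 2 (by omega)] at this
      exact absurd this (by simp [pattern])
    · convert h2.isPatternWeighting using 1
      · funext i
        split_ifs with h0
        · rfl
        · exact (h1 i 0 (by omega)).symm
      · funext i
        split_ifs with h0
        · rfl
        · exact (h1 i 1 (by omega)).symm
  · rintro ⟨hL, h⟩
    refine ⟨_, fun i k hk => ⟨⟨(h.isPathWeighting i k hk).1.1, ?_⟩, (h.isPathWeighting i k hk).2⟩⟩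
    have := hL i
    have hk2 : k < 2 := by omega
    interval_cases k <;> exact le_rfl

/-- The least length that agrees with `n` modulo `4` and has the same minimum with `2`. -/
def lengthClass (n : ℕ) : ℕ :=
  if n ≤ 1 then n else (n - 2) % 4 + 2

theorem lengthClass_eq_zero {n : ℕ} : lengthClass n = 0 ↔ n = 0 := by
  rcases n with _ | _ | n <;> simp [lengthClass]

theorem lengthClass_eq_one {n : ℕ} : lengthClass n = 1 ↔ n = 1 := by
  rcases n with _ | _ | n <;> simp [lengthClass]

theorem lengthClass_lt (n : ℕ) : lengthClass n < 6 := by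
  unfold lengthClass; split_ifs <;> omega

theorem lengthClass_mod_four (n : ℕ) : lengthClass n % 4 = n % 4 := by
  unfold lengthClass; split_ifs <;> omega

theorem startWeights_lengthClass (n : ℕ) : startWeights (lengthClass n) = startWeights n := by
  rcases n with _ | _ | n <;> rfl

theorem pattern_lengthClass_sub_one (n s t : ℕ) :
    pattern s t (lengthClass n - 1) = pattern s t (n - 1) := by
  rw [← pattern_mod_four, ← pattern_mod_four s t (n - 1)]
  congr 1
  unfold lengthClass; split_ifs <;> omega

theorem endsCompatible_lengthClass (n s t p q : ℕ) :
    endsCompatible (lengthClass n) s t p q = endsCompatible n s t p q := by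
  rcases n with _ | _ | n
  · rfl
  · rfl
  · have h : lengthClass (n + 2) = n % 4 + 2 := rfl
    have h1 : pattern s t (n % 4 + 1) = pattern s t (n + 1) := by
      rw [← pattern_mod_four, ← pattern_mod_four s t (n + 1)]
      congr 1
      omega
    simp only [h, endsCompatible, pattern_mod_four, h1]

/-- A path of length `n ≥ 2` gives the same constraints at its ends as one of length `n + 4`. -/
theorem isPatternWeighting_lengthClass {L : Fin 6 → ℕ} {l : Fin 4 → ℕ} {s t : Fin 6 → ℕ} :
    IsPatternWeighting (fun i => lengthClass (L i)) l s t ↔ IsPatternWeighting L l s t := by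
  have hc : ∀ x, patternCornerColor (fun i => lengthClass (L i)) l s t x =
      patternCornerColor L l s t x := by
    intro x
    rw [patternCornerColor, patternCornerColor, cornerColor, cornerColor]
    refine Finset.sum_congr rfl fun i _ => ?_
    by_cases h0 : L i = 0
    · rw [if_pos h0, if_pos (lengthClass_eq_zero.2 h0)]
    · rw [if_neg h0, if_neg (mt lengthClass_eq_zero.1 h0)]
      simp only [pattern_lengthClass_sub_one]
  simp only [IsPatternWeighting, startWeights_lengthClass, endsCompatible_lengthClass, hc]

theorem cornerLabel_congr {L L' : Fin 6 → ℕ} (h : ∀ i, L i = 0 ↔ L' i = 0) :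
    cornerLabel L = cornerLabel L' := by
  have : mergeEnds L = mergeEnds L' := by
    funext l i x
    simp only [mergeEnds, h]
  rw [cornerLabel, cornerLabel, this]

/-! ### The finite search -/

/-- The value `f n`. The case distinction makes the kernel evaluate `n` before it unfolds `f`. -/
def force (n : ℕ) (f : ℕ → Bool) : Bool :=
  match n with
  | 0 => f 0
  | n + 1 => f (n + 1)

theorem force_eq (n : ℕ) (f : ℕ → Bool) : force n f = f n := by
  cases n <;> rfl

/-- `endsCompatible`, for a path whose first two weights have the sum `h` and whose last two weights
have the sum `k`. -/
def endsDiffer (n h k p q : ℕ) : Bool :=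
  match n with
  | 0 => true
  | 1 => !p.beq q
  | _ + 2 => !p.beq h && !k.beq q

theorem endsDiffer_eq (n s t p q : ℕ) :
    endsDiffer n (s + t) (pattern s t (n - 2) + pattern s t (n - 1)) p q =
      endsCompatible n s t p q := by
  rcases n with _ | _ | n <;> rfl

/-- Search through the first two weights of a path of length `n`. The arguments `p` and `q` are the
powers of `32` that stand for the two ends; `T` collects the colours of all corners as digits to the
base `32`. The continuation `f` takes the new value of `T`, the sum of the first two weights and the
sum of the last two weights. -/
def branch (n p q T : ℕ) (f : ℕ → ℕ → ℕ → Bool) : Bool :=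
  (startWeights n).any fun x =>
    force (T + bif n.beq 0 then 0 else x.1 * p + pattern x.1 x.2 (n - 1) * q) fun T =>
    f T (x.1 + x.2) (pattern x.1 x.2 (n - 2) + pattern x.1 x.2 (n - 1))

/-- Search for the first two weights of all paths, of lengths `a, …, f`. The `i`-th corner with the
label `x` is given by `pᵢ = 32 ^ x`. -/
def searchPattern (p₀ p₁ p₂ p₃ a b c d e f : ℕ) : Bool :=
  branch a p₀ p₁ 0 fun T h₀ k₀ => branch b p₀ p₁ T fun T h₁ k₁ =>
  branch c p₂ p₃ T fun T h₂ k₂ => branch d p₂ p₃ T fun T h₃ k₃ =>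
  branch e p₀ p₂ T fun T h₄ k₄ => branch f p₁ p₃ T fun T h₅ k₅ =>
  force (T / p₀ % 32) fun c₀ => force (T / p₁ % 32) fun c₁ =>
    endsDiffer a h₀ k₀ c₀ c₁ && (endsDiffer b h₁ k₁ c₀ c₁ &&
  force (T / p₂ % 32) fun c₂ => force (T / p₃ % 32) fun c₃ =>
    endsDiffer c h₂ k₂ c₂ c₃ && (endsDiffer d h₃ k₃ c₂ c₃ &&
    (endsDiffer e h₄ k₄ c₀ c₂ && endsDiffer f h₅ k₅ c₁ c₃)))

theorem cond_beq (m k r r' : ℕ) : (bif m.beq k then r else r') = if m = k then r else r' := by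
  by_cases hmk : m = k
  · rw [if_pos hmk, hmk, Nat.beq_refl, cond_true]
  · rw [if_neg hmk, Bool.eq_false_iff.2 (mt Nat.eq_of_beq_eq_true hmk), cond_false]

theorem branch_eq_true_iff {n p q T : ℕ} {f : ℕ → ℕ → ℕ → Bool} :
    branch n p q T f = true ↔ ∃ s t, (s, t) ∈ startWeights n ∧
      f (T + if n = 0 then 0 else s * p + pattern s t (n - 1) * q) (s + t)
        (pattern s t (n - 2) + pattern s t (n - 1)) = true := by
  simp only [branch, List.any_eq_true, force_eq, cond_beq, Prod.exists]

/-- The colours of the corners, as digits to the base `32` at the places given by the labels. -/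
def colorDigits (L : Fin 6 → ℕ) (l : Fin 4 → Fin 4) (s t : Fin 6 → ℕ) : ℕ :=
  ∑ i, if L i = 0 then 0 else s i * 32 ^ (l (pathStart i) : ℕ) +
    pattern (s i) (t i) (L i - 1) * 32 ^ (l (pathEnd i) : ℕ)

/-- The digits are the colours, because six paths contribute at most `4` each. -/
theorem colorDigits_div_pow_mod {L : Fin 6 → ℕ} {l : Fin 4 → Fin 4} {s t : Fin 6 → ℕ}
    (h : ∀ i, (s i, t i) ∈ startWeights (L i)) (x : Fin 4) :
    colorDigits L l s t / 32 ^ (x : ℕ) % 32 =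
      patternCornerColor L (fun y => (l y : ℕ)) s t x := by
  have hsum : colorDigits L l s t =
      ∑ y : Fin 4, 32 ^ (y : ℕ) * patternCornerColor L (fun y => (l y : ℕ)) s t y := by
    simp only [patternCornerColor, cornerColor, Finset.mul_sum]
    rw [Finset.sum_comm, colorDigits]
    refine Finset.sum_congr rfl fun i _ => ?_
    split_ifs
    · simp
    · simp only [Fin.val_inj, mul_add, mul_ite, mul_zero, Finset.sum_add_distrib,
        Finset.sum_ite_eq, Finset.mem_univ, if_true, pattern_zero]
      ring
  have hlt : ∀ y : Fin 4, patternCornerColor L (fun y => (l y : ℕ)) s t y < 32 := by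
    intro y
    rw [patternCornerColor, cornerColor]
    refine lt_of_le_of_lt (Finset.sum_le_card_nsmul _ _ 4 fun i _ => ?_) (by decide)
    obtain ⟨hs, ht, -, -⟩ := mem_startWeights.1 (h i)
    have h0 := pattern_mem hs ht 0
    have h1 := pattern_mem hs ht (L i - 1)
    split_ifs <;> omega
  have h0 := hlt 0
  have h1 := hlt 1
  have h2 := hlt 2
  have h3 := hlt 3
  rw [hsum, Fin.sum_univ_four]
  fin_cases x <;> simp at h0 h1 h2 h3 ⊢ <;> omega

theorem isPatternWeighting_iff_digits {L : Fin 6 → ℕ} {l : Fin 4 → Fin 4} {s t : Fin 6 → ℕ} :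
    IsPatternWeighting L (fun y => (l y : ℕ)) s t ↔ (∀ i, (s i, t i) ∈ startWeights (L i)) ∧
      ∀ i, endsDiffer (L i) (s i + t i)
        (pattern (s i) (t i) (L i - 2) + pattern (s i) (t i) (L i - 1))
        (colorDigits L l s t / 32 ^ (l (pathStart i) : ℕ) % 32)
        (colorDigits L l s t / 32 ^ (l (pathEnd i) : ℕ) % 32) = true := by
  rw [IsPatternWeighting, forall_and, and_congr_right_iff]
  intro h
  simp only [endsDiffer_eq, colorDigits_div_pow_mod h]

theorem searchPattern_eq_true_iff (l : Fin 4 → Fin 4) (a b c d e f : ℕ) :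
    searchPattern (32 ^ (l 0 : ℕ)) (32 ^ (l 1 : ℕ)) (32 ^ (l 2 : ℕ)) (32 ^ (l 3 : ℕ)) a b c d e f =
      true ↔ ∃ s t, IsPatternWeighting ![a, b, c, d, e, f] (fun x => l x) s t := by
  simp only [searchPattern, branch_eq_true_iff, force_eq, Bool.and_eq_true,
    isPatternWeighting_iff_digits]
  constructor
  · rintro ⟨s₀, t₀, m₀, s₁, t₁, m₁, s₂, t₂, m₂, s₃, t₃, m₃, s₄, t₄, m₄, s₅, t₅, m₅,
      h₀, h₁, h₂, h₃, h₄, h₅⟩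
    have hT : colorDigits ![a, b, c, d, e, f] l ![s₀, s₁, s₂, s₃, s₄, s₅]
        ![t₀, t₁, t₂, t₃, t₄, t₅] = _ := Fin.sum_univ_six _
    rw [zero_add] at h₀ h₁ h₂ h₃ h₄ h₅
    refine ⟨![s₀, s₁, s₂, s₃, s₄, s₅], ![t₀, t₁, t₂, t₃, t₄, t₅], ?_, ?_⟩
    · intro i
      fin_cases i
      exacts [m₀, m₁, m₂, m₃, m₄, m₅]
    · intro i
      rw [hT]
      fin_cases i
      exacts [h₀, h₁, h₂, h₃, h₄, h₅]
  · rintro ⟨s, t, m, h⟩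
    have hT : colorDigits ![a, b, c, d, e, f] l s t = _ := Fin.sum_univ_six _
    rw [hT] at h
    refine ⟨_, _, m 0, _, _, m 1, _, _, m 2, _, _, m 3, _, _, m 4, _, _, m 5, ?_⟩
    rw [zero_add]
    exact ⟨h 0, h 1, h 2, h 3, h 4, h 5⟩

/-- The code `p + q` for each path of length `1`, where `p` and `q` stand for its ends, and `0` for
the other paths. -/
def edgeCodes (p₀ p₁ p₂ p₃ a b c d e f : ℕ) : List ℕ :=
  [bif a.beq 1 then p₀ + p₁ else 0, bif b.beq 1 then p₀ + p₁ else 0,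
    bif c.beq 1 then p₂ + p₃ else 0, bif d.beq 1 then p₂ + p₃ else 0,
    bif e.beq 1 then p₀ + p₂ else 0, bif f.beq 1 then p₁ + p₃ else 0]

/-- Whether a positive number occurs twice in a list. -/
def hasRepetition : List ℕ → Bool
  | [] => false
  | x :: t => (!x.beq 0 && t.any x.beq) || hasRepetition t

/-- `P` holds for all lengths below `n` that satisfy the parity conditions of a bipartite figure and
have a sum of at least `2`. -/
def forallLengths (n : ℕ) (P : ℕ → ℕ → ℕ → ℕ → ℕ → ℕ → Bool) : Bool :=
  (List.range n).all fun a => (List.range n).all fun b => !((a + b) % 2).beq 0 ||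
  (List.range n).all fun c => (List.range n).all fun d => !((c + d) % 2).beq 0 ||
  (List.range n).all fun e => (List.range n).all fun f => !((a + c + e + f) % 2).beq 0 ||
  !Nat.ble 2 (a + b + c + d + e + f) || P a b c d e f

theorem eq_true_of_forallLengths {n : ℕ} {P : ℕ → ℕ → ℕ → ℕ → ℕ → ℕ → Bool}
    (h : forallLengths n P = true) {a b c d e f : ℕ} (ha : a < n) (hb : b < n) (hc : c < n)
    (hd : d < n) (he : e < n) (hf : f < n) (hab : (a + b) % 2 = 0) (hcd : (c + d) % 2 = 0)
    (hef : (a + c + e + f) % 2 = 0) (hs : 2 ≤ a + b + c + d + e + f) : P a b c d e f = true := by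
  simp only [forallLengths, List.all_eq_true, List.mem_range, Bool.or_eq_true, not_beq_eq_true]
    at h
  have h₁ := (h a ha b hb).resolve_left (not_not.2 hab)
  exact ((h₁ c hc d hd).resolve_left (not_not.2 hcd) e he f hf).resolve_left
    (not_or.2 ⟨not_not.2 hef, by simpa using hs⟩)

instance (P : ℕ → ℕ → ℕ → ℕ → ℕ → ℕ → Prop) [∀ a b c d e f, Decidable (P a b c d e f)]
    (a b c d e f : ℕ) : Decidable (UpToSymmetry P a b c d e f) := by
  unfold UpToSymmetry; infer_instance

instance (a b c d e f : ℕ) : Decidable (MuOneList a b c d e f) := by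
  unfold MuOneList; infer_instance

instance (a b c d e f : ℕ) : Decidable (MuThreeList a b c d e f) := by
  unfold MuThreeList Nat.ModEq; infer_instance

/-- The code of the label of the corner `x`. -/
def cornerCode (L : Fin 6 → ℕ) (x : Fin 4) : ℕ := 32 ^ (cornerLabel L x : ℕ)

/-- Whether the search for weights `1` and `2` fails exactly for the lengths on the list, if the
figure has no parallel edges. -/
def searchAgrees (a b c d e f : ℕ) : Bool :=
  force (min a 1) fun a' => force (min b 1) fun b' => force (min c 1) fun c' =>
  force (min d 1) fun d' => force (min e 1) fun e' => force (min f 1) fun f' =>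
  force (cornerCode ![a', b', c', d', e', f'] 0) fun p₀ =>
  force (cornerCode ![a', b', c', d', e', f'] 1) fun p₁ =>
  force (cornerCode ![a', b', c', d', e', f'] 2) fun p₂ =>
  force (cornerCode ![a', b', c', d', e', f'] 3) fun p₃ =>
  hasRepetition (edgeCodes p₀ p₁ p₂ p₃ a b c d e f) ||
    (searchPattern p₀ p₁ p₂ p₃ a b c d e f != decide (UpToSymmetry MuThreeList a b c d e f))

theorem cornerLabel_min (a b c d e f : ℕ) :
    cornerLabel ![min a 1, min b 1, min c 1, min d 1, min e 1, min f 1] =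
      cornerLabel ![a, b, c, d, e, f] := by
  have hz : ∀ n, min n 1 = 0 ↔ n = 0 := by omega
  refine cornerLabel_congr fun i => ?_
  fin_cases i
  exacts [hz a, hz b, hz c, hz d, hz e, hz f]

/-- The lengths enter the corner labels only through their being zero. -/
theorem searchAgrees_eq (a b c d e f : ℕ) {L : Fin 6 → ℕ} (hL : ![a, b, c, d, e, f] = L) :
    searchAgrees a b c d e f =
      (hasRepetition (edgeCodes (cornerCode L 0) (cornerCode L 1) (cornerCode L 2)
        (cornerCode L 3) a b c d e f) ||
      (searchPattern (cornerCode L 0) (cornerCode L 1) (cornerCode L 2) (cornerCode L 3)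
        a b c d e f != decide (UpToSymmetry MuThreeList a b c d e f))) := by
  subst hL
  simp only [searchAgrees, force_eq, cornerCode, cornerLabel_min]

/-- Every length may be replaced by its class, so lengths up to `5` cover all cases. -/
theorem forallLengths_searchAgrees : forallLengths 6 searchAgrees = true := by
  decide +kernel

instance (L : Fin 6 → ℕ) (l : Fin 4 → ℕ) (s t : Fin 6 → ℕ) :
    Decidable (IsPatternWeighting L l s t) := by
  unfold IsPatternWeighting; infer_instance

/-- Whether the weights `1` are a solution exactly for the lengths on the list, if the figure has no
parallel edges and no path of length `2` is closed. -/
def onesAgree (a b c d e f : ℕ) : Bool :=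
  let L := ![a, b, c, d, e, f]
  let l := cornerLabel L
  hasRepetition (edgeCodes (cornerCode L 0) (cornerCode L 1) (cornerCode L 2) (cornerCode L 3)
    a b c d e f) ||
  decide (∃ i, L i = 2 ∧ l (pathStart i) = l (pathEnd i)) ||
  (decide (IsPatternWeighting L (fun x => l x) 1 1) ==
    decide (UpToSymmetry MuOneList a b c d e f))

/-- Paths of length `3` or more do not admit the constant weight `1`, so lengths up to
`2` suffice. -/
theorem forallLengths_onesAgree : forallLengths 3 onesAgree = true := by
  decide +kernel

theorem edgeCodes_cornerCode (a b c d e f : ℕ) (L : Fin 6 → ℕ) :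
    edgeCodes (cornerCode L 0) (cornerCode L 1) (cornerCode L 2) (cornerCode L 3) a b c d e f =
      (List.finRange 6).map fun i => if ![a, b, c, d, e, f] i = 1 then
        cornerCode L (pathStart i) + cornerCode L (pathEnd i) else 0 := by
  simp only [edgeCodes, cond_beq]
  rfl

theorem hasRepetition_eq_false {t : List ℕ} (h : t.Pairwise fun x y => x = y → x = 0) :
    hasRepetition t = false := by
  induction h with
  | nil => rfl
  | @cons x t hx _ ih =>
    have hx' : (!x.beq 0 && t.any x.beq) = false := by
      rw [← Bool.not_eq_true, Bool.and_eq_true, not_beq_eq_true, List.any_eq_true]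
      rintro ⟨h0, y, hy, hxy⟩
      exact h0 (hx y hy (Nat.eq_of_beq_eq_true hxy))
    rw [hasRepetition, hx', ih, Bool.or_self]

/-- A sum of two powers of `32` determines the exponents. -/
theorem pow_add_pow_inj : ∀ x y z u : Fin 4,
    32 ^ (x : ℕ) + 32 ^ (y : ℕ) = 32 ^ (z : ℕ) + 32 ^ (u : ℕ) →
      (x = z ∧ y = u) ∨ (x = u ∧ y = z) := by
  decide

theorem muThreeList_lengthClass (a b c d e f : ℕ) :
    MuThreeList (lengthClass a) (lengthClass b) (lengthClass c) (lengthClass d) (lengthClass e)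
      (lengthClass f) ↔ MuThreeList a b c d e f := by
  have hm : ∀ n r, lengthClass n ≡ r [MOD 4] ↔ n ≡ r [MOD 4] := by
    intro n r
    rw [Nat.ModEq, Nat.ModEq, lengthClass_mod_four]
  have hadd : ∀ r, lengthClass e + lengthClass f ≡ r [MOD 4] ↔ e + f ≡ r [MOD 4] := by
    intro r
    rw [Nat.ModEq, Nat.ModEq, Nat.add_mod, lengthClass_mod_four, lengthClass_mod_four,
      ← Nat.add_mod]
  have hone : lengthClass e + lengthClass f = 1 ↔ e + f = 1 := by
    rw [Nat.add_eq_one_iff, Nat.add_eq_one_iff, lengthClass_eq_zero, lengthClass_eq_zero,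
      lengthClass_eq_one, lengthClass_eq_one]
  simp only [MuThreeList, lengthClass_eq_zero, lengthClass_eq_one, hm, hadd, hone]

theorem upToSymmetry_muThreeList_lengthClass (a b c d e f : ℕ) :
    UpToSymmetry MuThreeList (lengthClass a) (lengthClass b) (lengthClass c) (lengthClass d)
      (lengthClass e) (lengthClass f) ↔ UpToSymmetry MuThreeList a b c d e f := by
  simp only [UpToSymmetry, muThreeList_lengthClass]

theorem le_two_of_muOneList {a b c d e f : ℕ} (h : MuOneList a b c d e f) :
    a ≤ 2 ∧ b ≤ 2 ∧ c ≤ 2 ∧ d ≤ 2 ∧ e ≤ 2 ∧ f ≤ 2 := by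
  unfold MuOneList at h
  omega

theorem le_two_of_upToSymmetry_muOneList {a b c d e f : ℕ}
    (h : UpToSymmetry MuOneList a b c d e f) :
    a ≤ 2 ∧ b ≤ 2 ∧ c ≤ 2 ∧ d ≤ 2 ∧ e ≤ 2 ∧ f ≤ 2 := by
  rcases h with (((h | h) | h | h) | (h | h) | h | h) | ((h | h) | h | h) | (h | h) | h | h
  all_goals
    have := le_two_of_muOneList h
    omega

/-! ### The value for a polygon figure -/

namespace PolygonFigure

variable {V : Type*} {G : SimpleGraph V}

theorem even_length_iff {L : Fin 6 → ℕ} (F : PolygonFigure G L) (κ : G.Coloring Bool)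
    (i : Fin 6) : Even (L i) ↔ (κ (F.corner (pathStart i)) ↔ κ (F.corner (pathEnd i))) := by
  rw [← F.length_path i]
  exact κ.even_length_iff_congr _

theorem cornerLabel_ne_of_length_eq_two {L : Fin 6 → ℕ} (F : PolygonFigure G L) {i : Fin 6}
    (hi : L i = 2) : cornerLabel L (pathStart i) ≠ cornerLabel L (pathEnd i) := by
  intro h
  have hc := (F.cornerLabel_eq_iff _ _).1 (congrArg Fin.val h)
  have h2 := (F.getVert_length i).trans hc.symm
  rw [hi] at h2
  -- a closed path of length two traverses its first edge twice
  have := F.edge_inj i i 0 (by omega) 1 (by omega) (by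
    rw [F.getVert_zero]
    exact Sym2.eq_iff.2 (Or.inr ⟨h2.symm, rfl⟩))
  omega

theorem not_hasRepetition {L : Fin 6 → ℕ} (F : PolygonFigure G L) :
    hasRepetition ((List.finRange 6).map fun i => if L i = 1 then
      cornerCode L (pathStart i) + cornerCode L (pathEnd i) else 0) = false := by
  refine hasRepetition_eq_false (List.pairwise_map.2 ((List.nodup_finRange 6).imp ?_))
  intro i j hij h
  by_cases hi : L i = 1
  · by_cases hj : L j = 1
    · rw [if_pos hi, if_pos hj] at h
      have hi' := F.getVert_length i
      have hj' := F.getVert_length j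
      rw [hi] at hi'
      rw [hj] at hj'
      refine absurd (F.edge_inj i j 0 (by omega) 0 (by omega) ?_).1 hij
      rw [zero_add, F.getVert_zero, F.getVert_zero, hi', hj', Sym2.eq_iff]
      simp only [← F.cornerLabel_eq_iff, Fin.val_inj]
      exact pow_add_pow_inj _ _ _ _ h
    · rwa [if_neg hj] at h
  · exact if_neg hi

/-- A connected graph has at most one vertex more than it has edges. -/
theorem card_le_sum_length [Fintype V] {L : Fin 6 → ℕ} (F : PolygonFigure G L) :
    Fintype.card V ≤ ∑ i, L i + 1 := by
  have h := F.connected.card_vert_le_card_edgeSet_add_one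
  rw [Nat.card_eq_fintype_card, ← Nat.card_congr (Equiv.ofBijective _ F.edge_bijective)] at h
  simpa using h

end PolygonFigure

namespace PolygonFigure

variable {V : Type*} {G : SimpleGraph V} {a b c d e f : ℕ}

theorem parity_conditions (F : PolygonFigure G ![a, b, c, d, e, f]) (hG : G.IsBipartite) :
    (a + b) % 2 = 0 ∧ (c + d) % 2 = 0 ∧ (a + c + e + f) % 2 = 0 := by
  obtain ⟨κ⟩ : Nonempty (G.Coloring Bool) := ⟨hG.toColoring (by simp)⟩
  have h0 : Even a ↔ (κ (F.corner 0) ↔ κ (F.corner 1)) := F.even_length_iff κ 0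
  have h1 : Even b ↔ (κ (F.corner 0) ↔ κ (F.corner 1)) := F.even_length_iff κ 1
  have h2 : Even c ↔ (κ (F.corner 2) ↔ κ (F.corner 3)) := F.even_length_iff κ 2
  have h3 : Even d ↔ (κ (F.corner 2) ↔ κ (F.corner 3)) := F.even_length_iff κ 3
  have h4 : Even e ↔ (κ (F.corner 0) ↔ κ (F.corner 2)) := F.even_length_iff κ 4
  have h5 : Even f ↔ (κ (F.corner 1) ↔ κ (F.corner 3)) := F.even_length_iff κ 5
  simp only [← Nat.even_iff, Nat.even_add, h0, h1, h2, h3, h4, h5]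
  generalize (κ (F.corner 0) = true) = p₀, (κ (F.corner 1) = true) = p₁,
    (κ (F.corner 2) = true) = p₂, (κ (F.corner 3) = true) = p₃
  by_cases p₀ <;> by_cases p₁ <;> by_cases p₂ <;> by_cases p₃ <;> simp [*]

theorem two_le_sum_length [Fintype V] (F : PolygonFigure G ![a, b, c, d, e, f])
    (hV : 3 ≤ Fintype.card V) : 2 ≤ a + b + c + d + e + f := by
  have h := F.card_le_sum_length
  rw [Fin.sum_univ_six] at h
  have : Fintype.card V ≤ a + b + c + d + e + f + 1 := h
  omega

variable [Fintype V] [DecidableRel G.Adj]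

theorem exists_isVCEW_one_iff (F : PolygonFigure G ![a, b, c, d, e, f])
    (hV : 3 ≤ Fintype.card V) (hG : G.IsBipartite) :
    (∃ w, IsVCEW G 1 w) ↔ UpToSymmetry MuOneList a b c d e f := by
  rw [F.exists_isVCEW_iff F.cornerLabel_eq_iff, exists_isPathWeighting_one_iff]
  have key : a ≤ 2 → b ≤ 2 → c ≤ 2 → d ≤ 2 → e ≤ 2 → f ≤ 2 →
      (IsPatternWeighting ![a, b, c, d, e, f] (fun x => cornerLabel ![a, b, c, d, e, f] x) 1 1 ↔
        UpToSymmetry MuOneList a b c d e f) := by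
    intro ha hb hc hd he hf
    obtain ⟨h₁, h₂, h₃⟩ := F.parity_conditions hG
    have h := eq_true_of_forallLengths forallLengths_onesAgree (Nat.lt_succ_of_le ha)
      (Nat.lt_succ_of_le hb) (Nat.lt_succ_of_le hc) (Nat.lt_succ_of_le hd) (Nat.lt_succ_of_le he)
      (Nat.lt_succ_of_le hf) h₁ h₂ h₃ (F.two_le_sum_length hV)
    simp only [onesAgree, edgeCodes_cornerCode, F.not_hasRepetition, Bool.false_or,
      Bool.or_eq_true, decide_eq_true_eq, beq_iff_eq, decide_eq_decide] at h
    exact h.resolve_left fun ⟨i, hi, hl⟩ => F.cornerLabel_ne_of_length_eq_two hi hl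
  constructor
  · rintro ⟨hL, h⟩
    exact (key (hL 0) (hL 1) (hL 2) (hL 3) (hL 4) (hL 5)).1 h
  · intro h
    obtain ⟨ha, hb, hc, hd, he, hf⟩ := le_two_of_upToSymmetry_muOneList h
    refine ⟨fun i => ?_, (key ha hb hc hd he hf).2 h⟩
    fin_cases i
    exacts [ha, hb, hc, hd, he, hf]

theorem exists_isVCEW_two_iff (F : PolygonFigure G ![a, b, c, d, e, f])
    (hV : 3 ≤ Fintype.card V) (hG : G.IsBipartite) :
    (∃ w, IsVCEW G 2 w) ↔ ¬ UpToSymmetry MuThreeList a b c d e f := by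
  rw [F.exists_isVCEW_iff F.cornerLabel_eq_iff, exists_isPathWeighting_two_iff]
  simp only [← isPatternWeighting_lengthClass (L := ![a, b, c, d, e, f])]
  have hclass : (fun i => lengthClass (![a, b, c, d, e, f] i)) = ![lengthClass a, lengthClass b,
      lengthClass c, lengthClass d, lengthClass e, lengthClass f] := by
    funext i
    fin_cases i <;> rfl
  have hrep : hasRepetition (edgeCodes (cornerCode ![a, b, c, d, e, f] 0)
      (cornerCode ![a, b, c, d, e, f] 1) (cornerCode ![a, b, c, d, e, f] 2)
      (cornerCode ![a, b, c, d, e, f] 3) (lengthClass a) (lengthClass b) (lengthClass c)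
      (lengthClass d) (lengthClass e) (lengthClass f)) = false := by
    rw [edgeCodes_cornerCode, ← hclass]
    simp only [lengthClass_eq_one]
    exact F.not_hasRepetition
  obtain ⟨h₁, h₂, h₃⟩ := F.parity_conditions hG
  have hs := F.two_le_sum_length hV
  have hmod := lengthClass_mod_four
  have hsum : 2 ≤ lengthClass a + lengthClass b + lengthClass c + lengthClass d + lengthClass e +
      lengthClass f := by
    have hmin : ∀ n, min n 2 ≤ lengthClass n := by
      intro n
      unfold lengthClass
      split_ifs <;> omega
    have := hmin a
    have := hmin b
    have := hmin c
    have := hmin d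
    have := hmin e
    have := hmin f
    omega
  have ha := hmod a
  have hb := hmod b
  have hc := hmod c
  have hd := hmod d
  have he := hmod e
  have hf := hmod f
  have h := eq_true_of_forallLengths forallLengths_searchAgrees (lengthClass_lt a)
    (lengthClass_lt b) (lengthClass_lt c) (lengthClass_lt d) (lengthClass_lt e) (lengthClass_lt f)
    (by omega) (by omega) (by omega) hsum
  have hlabel : cornerLabel ![lengthClass a, lengthClass b, lengthClass c, lengthClass d,
      lengthClass e, lengthClass f] = cornerLabel ![a, b, c, d, e, f] := by
    rw [← hclass]
    exact cornerLabel_congr fun i => lengthClass_eq_zero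
  rw [searchAgrees_eq _ _ _ _ _ _ rfl] at h
  simp only [cornerCode, hlabel] at h hrep
  rw [hrep, Bool.false_or, bne_iff_ne, ne_eq, Bool.eq_iff_iff, decide_eq_true_eq,
    searchPattern_eq_true_iff, upToSymmetry_muThreeList_lengthClass] at h
  rw [hclass]
  exact iff_not_comm.1 (not_iff.1 h).symm

end PolygonFigure

theorem IsVCEW.mono {V : Type*} [Fintype V] {G : SimpleGraph V} [DecidableRel G.Adj] {k m : ℕ}
    {w : G.edgeSet → ℕ} (h : IsVCEW G k w) (hkm : k ≤ m) : IsVCEW G m w :=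
  ⟨fun e => ⟨(h.1 e).1, (h.1 e).2.trans hkm⟩, h.2⟩

theorem mu_le_iff {V : Type*} [Fintype V] {G : SimpleGraph V} [DecidableRel G.Adj]
    (h : ∃ k w, IsVCEW G k w) (k : ℕ) : mu G ≤ k ↔ ∃ w, IsVCEW G k w := by
  constructor
  · intro hk
    obtain ⟨w, hw⟩ := Nat.sInf_mem (s := {k | ∃ w, IsVCEW G k w}) h
    exact ⟨w, hw.mono hk⟩
  · exact fun hk => Nat.sInf_le hk

theorem not_isVCEW_zero {V : Type*} [Fintype V] {G : SimpleGraph V} [DecidableRel G.Adj]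
    (hc : G.Connected) (hV : 2 ≤ Fintype.card V) (w : G.edgeSet → ℕ) : ¬ IsVCEW G 0 w := by
  intro h
  have : Nontrivial V := Fintype.one_lt_card_iff_nontrivial.1 hV
  obtain ⟨x⟩ := hc.nonempty
  obtain ⟨y, hy⟩ := hc.preconnected.exists_adj_of_nontrivial x
  have := h.1 ⟨s(x, y), hy⟩
  omega

theorem mainTheorem3 {V : Type*} [Fintype V] (G : SimpleGraph V) [DecidableRel G.Adj]
    (hV : 3 ≤ Fintype.card V) (hG : G.IsBipartite)
    (a b c d e f : ℕ) (F : PolygonFigure G ![a, b, c, d, e, f]) :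
    (mu G = 1 ↔ UpToSymmetry MuOneList a b c d e f) ∧
    (mu G = 3 ↔ UpToSymmetry MuThreeList a b c d e f) ∧
    (¬ UpToSymmetry MuOneList a b c d e f → ¬ UpToSymmetry MuThreeList a b c d e f →
      mu G = 2) := by
  have hex := exists_isVCEW_three G hV F.connected (hG.toColoring (by simp))
  have h₀ : ¬ mu G ≤ 0 := by
    rw [mu_le_iff ⟨3, hex⟩]
    rintro ⟨w, hw⟩
    exact not_isVCEW_zero F.connected (by omega) w hw
  have h₁ := (mu_le_iff ⟨3, hex⟩ 1).trans (F.exists_isVCEW_one_iff hV hG)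
  have h₂ := (mu_le_iff ⟨3, hex⟩ 2).trans (F.exists_isVCEW_two_iff hV hG)
  have h₃ := (mu_le_iff ⟨3, hex⟩ 3).2 hex
  refine ⟨?_, ?_, fun h h' => ?_⟩
  · rw [← h₁]
    omega
  · rw [← not_iff_not, ← h₂]
    omega
  · rw [← h₁] at h
    rw [← h₂] at h'
    omega
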